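/- Let $X$ be a separable Banach space over $\mathbb{R}$ or $\mathbb{C}$, with dual space $X^*$. A sequence $(f_n)_{n\in\mathbb{N}}$ in $X^*$ is called almost overtotal on $X$ if for every subsequence $(f_{n_k})_{k\in\mathbb{N}}$ (with $n_0<n_1<\cdots$) the annihilator $\{x\in X : f_{n_k}(x)=0 \text{ for all } k\in\mathbb{N}\}$ is finite-dimensional. Then every bounded sequence in $X^*$ that is almost overtotal on $X$ is relatively norm-compact, that is, the norm closure of the set $\{f_n : n\in\mathbb{N}\}$ in $X^*$ is compact in the norm topology. -/

import Mathlib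

/-- The annihilator in `X` of a set `S` of continuous functionals on `X`:
all `x` with `g x = 0` for every `g ∈ S`. -/
def annihilatorIn {𝕜 X : Type*} [RCLike 𝕜] [NormedAddCommGroup X] [NormedSpace 𝕜 X]
    (S : Set (StrongDual 𝕜 X)) : Submodule 𝕜 X where
  carrier := {x | ∀ g ∈ S, g x = 0}
  zero_mem' := fun g _ => map_zero g
  add_mem' := fun {x y} hx hy g hg => by rw [map_add, hx g hg, hy g hg, add_zero]
  smul_mem' := fun c x hx g hg => by rw [map_smul, hx g hg, smul_zero]

/-- A sequence in the dual space is almost overtotal on `X` if the annihilator in `X` of each of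
its subsequences has finite dimension. -/
def AlmostOvertotal {𝕜 X : Type*} [RCLike 𝕜] [NormedAddCommGroup X] [NormedSpace 𝕜 X]
    (f : ℕ → StrongDual 𝕜 X) : Prop :=
  ∀ φ : ℕ → ℕ, StrictMono φ →
    FiniteDimensional 𝕜 (annihilatorIn (Set.range fun n => f (φ n)))

open Filter Topology

section

variable {𝕜 X : Type*} [RCLike 𝕜] [NormedAddCommGroup X] [NormedSpace 𝕜 X]

/-! If the range is not totally bounded, it has an ε-separated subsequence, and separability of `X`
gives a further one converging pointwise to some `h`. At most one term lies within ε/2 of `h`, so a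
tail of the differences `f n - h` is weak*-null and bounded below in norm. Such a sequence has a
subsequence with biorthogonal vectors, built from a triangular system by convergent successive
corrections. Its even-indexed differences kill all odd-indexed vectors, so their annihilator is
infinite-dimensional. Intersecting with `ker h` costs at most one dimension, and there the
differences agree with the `f n`: a contradiction. -/

/-- For a pointwise null sequence `g` of functionals, finitely many functionals are annihilated
by a bounded operator which asymptotically does not change `g`. -/
theorem exists_annihilating_operator {g : ℕ → StrongDual 𝕜 X}
    (hg : ∀ x, Tendsto (fun n => g n x) atTop (𝓝 0)) (t : Finset (StrongDual 𝕜 X)) :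
    ∃ P : X →L[𝕜] X, (∀ h ∈ t, ∀ x, h (P x) = 0) ∧
      Tendsto (fun n => (g n).comp P - g n) atTop (𝓝 0) := by
  classical
  induction t using Finset.induction_on with
  | empty => exact ⟨ContinuousLinearMap.id 𝕜 X, by simp, by simp⟩
  | insert h t _ ih =>
    obtain ⟨P, hP, hlim⟩ := ih
    by_cases hz : ∃ z, h (P z) ≠ 0
    · obtain ⟨z, hz⟩ := hz
      -- Rank-one correction along `P z`. It changes `(g n).comp P` by a multiple of `h.comp P`
      -- whose coefficient is `g n` at a fixed vector, hence tends to 0.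
      refine ⟨P - ((h.comp P).smulRight ((h (P z))⁻¹ • P z)), ?_, ?_⟩
      · intro k hk x
        rcases Finset.mem_insert.1 hk with rfl | hk
        · simp [hz]
        · simp [hP k hk]
      · have h1 : Tendsto (fun n => (g n ((h (P z))⁻¹ • P z)) • h.comp P) atTop (𝓝 0) := by
          rw [← zero_smul 𝕜 (h.comp P)]
          exact (hg ((h (P z))⁻¹ • P z)).smul_const (h.comp P)
        have h2 := hlim.sub h1
        rw [sub_zero] at h2
        refine h2.congr fun n => ?_
        ext x
        simp
        ring
    · push Not at hz
      refine ⟨P, fun k hk x => ?_, hlim⟩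
      rcases Finset.mem_insert.1 hk with rfl | hk
      · exact hz x
      · exact hP k hk x

/-- Functionals far along a pointwise null, norm-bounded-below sequence are normalized by vectors
of uniformly bounded norm in the kernel of finitely many prescribed functionals. -/
theorem exists_bound_eventually_exists_apply_eq_one {g : ℕ → StrongDual 𝕜 X}
    (hg : ∀ x, Tendsto (fun n => g n x) atTop (𝓝 0)) {δ : ℝ} (hδ : 0 < δ)
    (hgδ : ∀ n, δ ≤ ‖g n‖) (t : Finset (StrongDual 𝕜 X)) :
    ∃ C : ℝ, 0 ≤ C ∧ ∀ᶠ n in atTop, ∃ v, (∀ h ∈ t, h v = 0) ∧ g n v = 1 ∧ ‖v‖ ≤ C := by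
  obtain ⟨P, hP, hlim⟩ := exists_annihilating_operator hg t
  refine ⟨(δ / 2)⁻¹ * ‖P‖, by positivity, ?_⟩
  have h0 : ∀ᶠ n in atTop, ‖(g n).comp P - g n‖ < δ / 2 := by
    have := hlim.norm
    rw [norm_zero] at this
    exact this.eventually (gt_mem_nhds (half_pos hδ))
  filter_upwards [h0] with n hn
  have h1 : δ / 2 < ‖(g n).comp P‖ := by
    have := norm_sub_norm_le (g n) ((g n).comp P)
    rw [norm_sub_rev] at this
    linarith [hgδ n]
  obtain ⟨x, hx, hxP⟩ := ((g n).comp P).exists_lt_apply_of_lt_opNorm h1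
  have hpos : 0 < ‖g n (P x)‖ := lt_trans (half_pos hδ) hxP
  refine ⟨(g n (P x))⁻¹ • P x, fun h hh => by simp [hP h hh], ?_, ?_⟩
  · simp [norm_pos_iff.1 hpos]
  · rw [norm_smul, norm_inv]
    gcongr
    · exact hxP.le
    · exact (P.le_opNorm x).trans (mul_le_of_le_one_right (norm_nonneg _) hx.le)

/-- A pointwise null sequence of functionals which is bounded below in norm has a subsequence
forming, with suitable vectors, a triangular system with rapidly decreasing entries. -/
theorem exists_triangular_subseq {g : ℕ → StrongDual 𝕜 X}
    (hg : ∀ x, Tendsto (fun n => g n x) atTop (𝓝 0)) {δ : ℝ} (hδ : 0 < δ)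
    (hgδ : ∀ n, δ ≤ ‖g n‖) :
    ∃ (φ : ℕ → ℕ) (y : ℕ → X), StrictMono φ ∧ (∀ k, g (φ k) (y k) = 1) ∧
      (∀ j k, j < k → g (φ j) (y k) = 0) ∧
      ∀ j k, j < k → ‖g (φ k) (y j)‖ * (1 + ‖y k‖) ≤ (1 / 4) ^ k := by
  classical
  -- Triples (index, position, vector). The position is recorded because the relation cannot see the
  -- place `k` in the sequence; positions increase strictly, so the `k`-th is at least `k`.
  obtain ⟨F, hF, hF'⟩ := exists_seq_of_forall_finset_exists
    (fun a : ℕ × ℕ × X => g a.1 a.2.2 = 1)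
    (fun a b : ℕ × ℕ × X => a.1 < b.1 ∧ a.2.1 < b.2.1 ∧ g a.1 b.2.2 = 0 ∧
      ‖g b.1 a.2.2‖ * (1 + ‖b.2.2‖) ≤ (1 / 4 : ℝ) ^ b.2.1) (by
    intro s _
    obtain ⟨C, hC, hev⟩ := exists_bound_eventually_exists_apply_eq_one hg hδ hgδ
      (s.image fun a => g a.1)
    set p := s.sup (fun a => a.2.1) + 1 with hp
    -- `C` bounds the next vector before it is chosen, so `n` can be taken large first.
    have h1 : ∀ᶠ n in atTop, ∀ a ∈ s, ‖g n a.2.2‖ * (1 + C) < (1 / 4 : ℝ) ^ p := by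
      refine (eventually_all_finset s).2 fun a _ => ?_
      have := (hg a.2.2).norm.mul_const (1 + C)
      rw [norm_zero, zero_mul] at this
      exact this.eventually (gt_mem_nhds (by positivity))
    obtain ⟨n, ⟨v, hv0, hv1, hvC⟩, hn, hnS⟩ :=
      (hev.and (h1.and (eventually_gt_atTop (s.sup fun a => a.1)))).exists
    refine ⟨(n, p, v), hv1, fun a ha => ⟨?_, ?_, ?_, ?_⟩⟩
    · exact (Finset.le_sup (f := fun a : ℕ × ℕ × X => a.1) ha).trans_lt hnS
    · exact Nat.lt_succ_of_le (Finset.le_sup (f := fun a : ℕ × ℕ × X => a.2.1) ha)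
    · exact hv0 _ (Finset.mem_image_of_mem _ ha)
    · refine le_trans ?_ (hn a ha).le
      dsimp only
      gcongr)
  have hmono : StrictMono fun k => (F k).2.1 := fun a b hab => (hF' a b hab).2.1
  refine ⟨fun k => (F k).1, fun k => (F k).2.2, fun a b hab => (hF' a b hab).1, hF,
    fun j k hjk => (hF' j k hjk).2.2.1, fun j k hjk => (hF' j k hjk).2.2.2.trans ?_⟩
  exact pow_le_pow_of_le_one (by norm_num) (by norm_num) (hmono.le_apply (x := k))

/-- Triangular systems with rapidly decreasing entries can be solved for rapidly decreasing
right-hand sides. -/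
theorem exists_solution_of_triangular [CompleteSpace X] {g : ℕ → StrongDual 𝕜 X} {y : ℕ → X}
    (h1 : ∀ k, g k (y k) = 1) (h0 : ∀ j k, j < k → g j (y k) = 0)
    (hs : ∀ j k, j < k → ‖g k (y j)‖ * (1 + ‖y k‖) ≤ (1 / 4) ^ k)
    (b : ℕ → 𝕜) {D : ℝ} (hD : 0 ≤ D) (hb : ∀ j, ‖b j‖ * (1 + ‖y j‖) ≤ D * (1 / 2) ^ j) :
    ∃ x, ∀ j, g j x = b j := by
  -- Step `j` repairs equation `j`; triangularity keeps later steps from disturbing it.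
  let x : ℕ → X := fun n => Nat.rec 0 (fun j v => v + (b j - g j v) • y j) n
  have hx : ∀ j, x (j + 1) = x j + (b j - g j (x j)) • y j := fun j => rfl
  have hp : ∀ j : ℕ, (1 / 4 : ℝ) ^ j * 2 ^ j = (1 / 2) ^ j := fun j => by
    rw [← mul_pow]; norm_num
  -- Correction `j` has coefficient at most `D * 2 ^ j`; these sum to `D * (2 ^ j - 1)`, which the
  -- decay `(1 / 4) ^ m` beats.
  have key : ∀ j m, j ≤ m → ‖g m (x j)‖ * (1 + ‖y m‖) ≤ D * (2 ^ j - 1) * (1 / 4) ^ m := by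
    intro j
    induction j with
    | zero => intro m _; simp [x]
    | succ j ih =>
      intro m hm
      have hc : ‖b j - g j (x j)‖ ≤ D * 2 ^ j := by
        calc ‖b j - g j (x j)‖ ≤ (‖b j‖ + ‖g j (x j)‖) * (1 + ‖y j‖) :=
              (norm_sub_le _ _).trans (le_mul_of_one_le_right (by positivity) (by simp))
          _ ≤ D * (1 / 2) ^ j + D * (2 ^ j - 1) * (1 / 4) ^ j := by
              rw [add_mul]; exact add_le_add (hb j) (ih j le_rfl)
          _ ≤ D * 1 + D * (2 ^ j - 1) * 1 := by
              have : (1 : ℝ) ≤ 2 ^ j := one_le_pow₀ (by norm_num)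
              have h2 : 0 ≤ D * (2 ^ j - 1) := mul_nonneg hD (by linarith)
              exact add_le_add
                (mul_le_mul_of_nonneg_left (pow_le_one₀ (by norm_num) (by norm_num)) hD)
                (mul_le_mul_of_nonneg_left (pow_le_one₀ (by norm_num) (by norm_num)) h2)
          _ = D * 2 ^ j := by ring
      calc ‖g m (x (j + 1))‖ * (1 + ‖y m‖)
          ≤ (‖g m (x j)‖ + ‖b j - g j (x j)‖ * ‖g m (y j)‖) * (1 + ‖y m‖) := by
            gcongr
            rw [hx, map_add, map_smul, smul_eq_mul, ← norm_mul]
            exact norm_add_le _ _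
        _ = ‖g m (x j)‖ * (1 + ‖y m‖) + ‖b j - g j (x j)‖ * (‖g m (y j)‖ * (1 + ‖y m‖)) := by
            ring
        _ ≤ D * (2 ^ j - 1) * (1 / 4) ^ m + D * 2 ^ j * (1 / 4) ^ m := by
            exact add_le_add (ih m (by omega))
              (mul_le_mul hc (hs j m (by omega)) (by positivity) (by positivity))
        _ = D * (2 ^ (j + 1) - 1) * (1 / 4) ^ m := by ring
  have hstep : ∀ j, dist (x j) (x (j + 1)) ≤ 2 * D * (1 / 2) ^ j := by
    intro j
    rw [dist_comm, dist_eq_norm, hx, add_sub_cancel_left, norm_smul]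
    calc ‖b j - g j (x j)‖ * ‖y j‖ ≤ (‖b j‖ + ‖g j (x j)‖) * (1 + ‖y j‖) := by
          gcongr
          · exact norm_sub_le _ _
          · simp
      _ ≤ D * (1 / 2) ^ j + D * (2 ^ j - 1) * (1 / 4) ^ j := by
          rw [add_mul]; exact add_le_add (hb j) (key j j le_rfl)
      _ = 2 * D * (1 / 2) ^ j - D * (1 / 4) ^ j := by rw [← hp j]; ring
      _ ≤ 2 * D * (1 / 2) ^ j := sub_le_self _ (by positivity)
  obtain ⟨z, hz⟩ := cauchySeq_tendsto_of_complete
    (cauchySeq_of_le_geometric (1 / 2) (2 * D) (by norm_num) hstep)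
  have hfix : ∀ j m, j < m → g j (x m) = b j := by
    intro j m hjm
    induction m, hjm using Nat.le_induction with
    | base => simp [hx, h1]
    | succ m hm ih => simp [hx, h0 j m hm, ih]
  refine ⟨z, fun j => tendsto_nhds_unique (((g j).continuous.tendsto z).comp hz) ?_⟩
  exact tendsto_const_nhds.congr' ((eventually_gt_atTop j).mono fun m hm => (hfix j m hm).symm)

/-- A pointwise null sequence of functionals on a Banach space which is bounded below in norm has
a subsequence admitting a biorthogonal sequence of vectors. -/
theorem exists_biorthogonal_subseq [CompleteSpace X] {g : ℕ → StrongDual 𝕜 X}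
    (hg : ∀ x, Tendsto (fun n => g n x) atTop (𝓝 0)) {δ : ℝ} (hδ : 0 < δ)
    (hgδ : ∀ n, δ ≤ ‖g n‖) :
    ∃ (φ : ℕ → ℕ) (x : ℕ → X), StrictMono φ ∧
      ∀ i j, g (φ j) (x i) = (Pi.single i 1 : ℕ → 𝕜) j := by
  obtain ⟨φ, y, hφ, h1, h0, hs⟩ := exists_triangular_subseq hg hδ hgδ
  have : ∀ i, ∃ x, ∀ j, g (φ j) x = (Pi.single i 1 : ℕ → 𝕜) j := fun i => by
    refine exists_solution_of_triangular (g := fun k => g (φ k)) h1 h0 hs (Pi.single i 1)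
      (D := 2 ^ i * (1 + ‖y i‖)) (by positivity) fun j => ?_
    rcases eq_or_ne j i with rfl | hj
    · rw [mul_right_comm, ← mul_pow]
      simp
    · rw [Pi.single_eq_of_ne hj]
      simp only [norm_zero, zero_mul]
      positivity
  choose x hx using this
  exact ⟨φ, x, hφ, hx⟩

/-- A sequence in a metric space whose range is not totally bounded has a uniformly separated
subsequence. -/
theorem exists_separated_subseq {E : Type*} [PseudoMetricSpace E] {f : ℕ → E}
    (hf : ¬ TotallyBounded (Set.range f)) :
    ∃ ε > 0, ∃ φ : ℕ → ℕ, StrictMono φ ∧ ∀ m n, m < n → ε ≤ dist (f (φ m)) (f (φ n)) := by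
  classical
  rw [Metric.totallyBounded_iff] at hf
  push Not at hf
  obtain ⟨ε, hε, hf⟩ := hf
  obtain ⟨φ, -, hφ⟩ := exists_seq_of_forall_finset_exists (fun _ : ℕ => True)
    (fun m n => m < n ∧ ε ≤ dist (f m) (f n)) (by
    intro s _
    -- Adjoining an initial segment of indices forces the new index past all of `s`.
    have hne := hf (f '' (↑(s ∪ Finset.range (s.sup id + 1)) : Set ℕ))
      ((Finset.finite_toSet _).image f)
    obtain ⟨_, ⟨n, rfl⟩, hn⟩ := Set.not_subset.1 hne
    have hfar : ∀ m ∈ s ∪ Finset.range (s.sup id + 1), ε ≤ dist (f m) (f n) := by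
      intro m hm
      by_contra! hlt
      exact hn (Set.mem_biUnion (Set.mem_image_of_mem f (Finset.mem_coe.2 hm))
        (by rwa [Metric.mem_ball, dist_comm]))
    have hns : s.sup id < n := by
      by_contra! hle
      have := hfar n (Finset.mem_union_right _ (Finset.mem_range.2 (Nat.lt_succ_of_le hle)))
      rw [dist_self] at this
      linarith
    exact ⟨n, trivial, fun m hm => ⟨(Finset.le_sup (f := id) hm).trans_lt hns,
      hfar m (Finset.mem_union_left _ hm)⟩⟩)
  exact ⟨ε, hε, φ, fun m n h => (hφ m n h).1, fun m n h => (hφ m n h).2⟩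

/-- A bounded sequence of functionals on a separable space has a pointwise convergent
subsequence. -/
theorem exists_pointwise_tendsto_subseq [TopologicalSpace.SeparableSpace X]
    {f : ℕ → StrongDual 𝕜 X} (hf : Bornology.IsBounded (Set.range f)) :
    ∃ (h : StrongDual 𝕜 X) (φ : ℕ → ℕ), StrictMono φ ∧
      ∀ x, Tendsto (fun n => f (φ n) x) atTop (𝓝 (h x)) := by
  obtain ⟨R, hR⟩ := hf.subset_closedBall 0
  obtain ⟨h, -, φ, hφ, hlim⟩ := WeakDual.isSeqCompact_closedBall 𝕜 X 0 R
    (x := fun n => StrongDual.toWeakDual (f n)) (fun n => hR (Set.mem_range_self n))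
  refine ⟨WeakDual.toStrongDual h, φ, hφ, fun x => ?_⟩
  exact ((WeakDual.eval_continuous x).tendsto h).comp hlim

/-- A sequence that converges pointwise and stays away from its limit in norm has a subsequence
with infinite-dimensional annihilator. -/
theorem not_almostOvertotal_of_pointwise_tendsto [CompleteSpace X] {f : ℕ → StrongDual 𝕜 X}
    {h : StrongDual 𝕜 X} (hlim : ∀ x, Tendsto (fun n => f n x) atTop (𝓝 (h x)))
    {δ : ℝ} (hδ : 0 < δ) (hfδ : ∀ n, δ ≤ ‖f n - h‖) : ¬ AlmostOvertotal f := by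
  intro hf
  obtain ⟨φ, x, hφ, hx⟩ := exists_biorthogonal_subseq (g := fun n => f n - h)
    (fun x => by simpa using (hlim x).sub_const (h x)) hδ hfδ
  have hfin := hf (fun n => φ (2 * n)) (hφ.comp fun a b hab => by omega)
  let K : Submodule 𝕜 X := annihilatorIn (Set.range fun n => f (φ (2 * n)) - h)
  have hK : K.FG := by
    -- The image of `K` under `h` lies in the scalars, so only `K ⊓ ker h` matters.
    refine Submodule.fg_of_fg_map_of_fg_inf_ker (h : X →ₗ[𝕜] 𝕜) (IsNoetherian.noetherian _) ?_
    have hle : K ⊓ LinearMap.ker (h : X →ₗ[𝕜] 𝕜) ≤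
        annihilatorIn (Set.range fun n => f (φ (2 * n))) := by
      rintro v ⟨hv, hv0⟩ _ ⟨n, rfl⟩
      have h1 : (f (φ (2 * n)) - h) v = 0 := hv _ ⟨n, rfl⟩
      have h2 : h v = 0 := hv0
      simpa [h2] using h1
    have := Submodule.finiteDimensional_of_le hle
    exact Module.Finite.iff_fg.1 this
  have : FiniteDimensional 𝕜 K := Module.Finite.iff_fg.2 hK
  let v : ℕ → K := fun i => ⟨x (2 * i + 1), by
    rintro _ ⟨n, rfl⟩
    dsimp only
    rw [hx, Pi.single_eq_of_ne (by omega)]⟩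
  have hli : LinearIndependent 𝕜 v := by
    refine LinearIndependent.of_pairwise_dual_eq_zero_one v
      (fun i => ((f (φ (2 * i + 1)) - h : StrongDual 𝕜 X) : X →ₗ[𝕜] 𝕜).comp K.subtype) ?_ ?_
    · intro i j hij
      exact (hx _ _).trans (Pi.single_eq_of_ne (by omega) _)
    · intro i
      exact (hx _ _).trans (Pi.single_eq_same _ _)
  exact not_finite_iff_infinite.2 inferInstance hli.finite_of_isNoetherian

end

theorem AlmostOvertotal.comp_strictMono {𝕜 X : Type*} [RCLike 𝕜] [NormedAddCommGroup X]
    [NormedSpace 𝕜 X] {f : ℕ → StrongDual 𝕜 X} (hf : AlmostOvertotal f) {φ : ℕ → ℕ}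
    (hφ : StrictMono φ) : AlmostOvertotal (f ∘ φ) :=
  fun ψ hψ => hf (φ ∘ ψ) (hφ.comp hψ)

theorem theorem2p3 {𝕜 X : Type*} [RCLike 𝕜] [NormedAddCommGroup X] [NormedSpace 𝕜 X]
    [CompleteSpace X] [TopologicalSpace.SeparableSpace X]
    (f : ℕ → StrongDual 𝕜 X) (hbdd : Bornology.IsBounded (Set.range f))
    (hf : AlmostOvertotal f) :
    IsCompact (closure (Set.range f)) := by
  suffices h : TotallyBounded (Set.range f) from
    h.closure.isCompact_of_isClosed isClosed_closure
  by_contra hnot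
  obtain ⟨ε, hε, φ, hφ, hsep⟩ := exists_separated_subseq hnot
  obtain ⟨h, ψ, hψ, hlim⟩ := exists_pointwise_tendsto_subseq (f := f ∘ φ)
    (hbdd.subset (Set.range_comp_subset_range φ f))
  obtain ⟨N, hN⟩ : ∃ N, ∀ n, ε / 2 ≤ ‖f (φ (ψ (n + N))) - h‖ := by
    -- Two terms within ε/2 of `h` would violate separation, so every term after a close one is far.
    by_cases hex : ∃ m, ‖f (φ (ψ m)) - h‖ < ε / 2
    · obtain ⟨m, hm⟩ := hex
      refine ⟨m + 1, fun n => ?_⟩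
      have h1 := hsep (ψ m) (ψ (n + (m + 1))) (hψ (by omega))
      have h2 := dist_triangle_right (f (φ (ψ m))) (f (φ (ψ (n + (m + 1))))) h
      rw [dist_eq_norm _ h, dist_eq_norm _ h] at h2
      linarith
    · push Not at hex
      exact ⟨0, fun n => hex _⟩
  have hshift : StrictMono fun n => n + N := fun a b hab => Nat.add_lt_add_right hab N
  exact not_almostOvertotal_of_pointwise_tendsto
    (fun x => (hlim x).comp (tendsto_add_atTop_nat N)) (half_pos hε) hN
    (hf.comp_strictMono (hφ.comp (hψ.comp hshift)))
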